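/- Let $N=2^n$. For $S\subseteq\{0,1\}^n$ non-empty put $|S\rangle=|S|^{-1/2}\sum_{x\in S}|x\rangle$. For every $n$ let $m_n\ge 0$ be a number of available ancilla qubits and let $\mathcal G_n$ be a finite set of placed gates on $n+m_n$ qubits; a placed gate is a unitary on some number of qubits together with the list of distinct qubits on which it acts. Assume that there is a constant $d$ such that $|\mathcal G_n|\le N^{d}$ for all large $n$; this holds in particular if there are only $n^{O(1)}$ choices of a gate and of the qubit indices on which it acts. For an $n$-qubit state $|a\rangle$ and a real $\epsilon$, the $\epsilon$-approximate circuit complexity $\mathcal C_\epsilon(|a\rangle)\in\mathbb N\cup\{\infty\}$ is the minimal number of gates in a circuit $C$ over $\mathcal G_n$ with $$\bigl|\langle a|\langle 0^{m_n}|\,C\,|0^n\rangle|0^{m_n}\rangle\bigr|\ge 1-\epsilon .$$ Let $\epsilon=\epsilon(n)$ satisfy $\epsilon=\omega(1/N)$, that is $N\epsilon(n)\to\infty$, and suppose that for some constant $c<1-\frac{1}{\sqrt2}$ we have $\epsilon(n)\le c$ for all large $n$ (for example $\epsilon<\frac14$). Then there exist subsets $S_n\subseteq\{0,1\}^n$ with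 $|S_n|=N/2$ ($n\ge1$) such that $$\mathcal C_{\epsilon(n)}(|S_n\rangle)=\tilde\Omega(N),$$ i.e. there are constants $A>0$ and $k\in\mathbb N$ with $\mathcal C_{\epsilon(n)}(|S_n\rangle)\ge A\,N/(\log N)^k$ for all sufficiently large $n$. -/

import Mathlib

open Filter Topology

noncomputable section

/-- `{0,1}^q`; its elements label the computational basis of a `q`-qubit register. -/
abbrev BitString (q : ℕ) : Type := Fin q → Bool

/-- State vectors of a `q`-qubit register, with the Euclidean norm. -/
abbrev QState (q : ℕ) : Type := EuclideanSpace ℂ (BitString q)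

/-- The basis state `|0…0⟩` of `q` qubits. -/
def zeroState (q : ℕ) : QState q := EuclideanSpace.single (fun _ => false) 1

/-- The subset state `|S⟩ = |S|^{-1/2} ∑_{x ∈ S} |x⟩`. -/
def subsetState {n : ℕ} (S : Finset (BitString n)) : QState n :=
  WithLp.toLp 2 (fun x => if x ∈ S then (((1 / Real.sqrt (S.card : ℝ) : ℝ)) : ℂ) else 0)

/-- The state `|a⟩|0…0⟩`: the `n`-qubit state `a` next to `m` ancilla qubits in state `|0⟩`. -/
def withAncillas {n : ℕ} (m : ℕ) (a : QState n) : QState (n + m) :=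
  WithLp.toLp 2 (fun x =>
    if ∀ j : Fin m, x (Fin.natAdd n j) = false then a (fun i => x (Fin.castAdd m i)) else 0)

/-- One choice of a gate together with the (distinct, ordered) qubits of a `q`-qubit register
on which it acts. -/
structure PlacedGate (q : ℕ) where
  arity : ℕ
  gate : Matrix.unitaryGroup (BitString arity) ℂ
  wires : Fin arity ↪ Fin q

/-- The matrix, on the whole register, of a placed gate: the gate on its own qubits, tensored
with the identity on all the others. -/
def PlacedGate.toMatrix {q : ℕ} (g : PlacedGate q) : Matrix (BitString q) (BitString q) ℂ :=
  open Classical in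
  fun x y =>
    if ∀ i, i ∉ Set.range g.wires → x i = y i then
      (g.gate : Matrix (BitString g.arity) (BitString g.arity) ℂ)
        (fun j => x (g.wires j)) (fun j => y (g.wires j))
    else 0

/-- The matrix of a circuit, given as the list of its gates in the order of application. -/
def circuitMatrix {q : ℕ} : List (PlacedGate q) → Matrix (BitString q) (BitString q) ℂ
  | [] => 1
  | g :: C => circuitMatrix C * g.toMatrix

/-- The amplitude `⟨b|⟨0…0| C |a⟩|0…0⟩`. -/
def transitionAmplitude {n m : ℕ} (C : List (PlacedGate (n + m))) (a b : QState n) : ℂ :=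
  inner ℂ (withAncillas m b) (Matrix.toEuclideanLin (circuitMatrix C) (withAncillas m a))

/-- The relative complexity `C_ε(|a⟩, |b⟩)`: the minimal number of gates, all taken from `G`, of a
circuit with `|⟨b|⟨0…0| C |a⟩|0…0⟩| ≥ 1 - ε`. It is `⊤` if there is no such circuit. -/
def relativeComplexity {n m : ℕ} (G : Finset (PlacedGate (n + m))) (ε : ℝ) (a b : QState n) :
    ℕ∞ :=
  ⨅ (C : List (PlacedGate (n + m))) (_ : ∀ g ∈ C, g ∈ G)
    (_ : 1 - ε ≤ ‖transitionAmplitude C a b‖), (C.length : ℕ∞)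

/-- The circuit complexity `C_ε(|a⟩) = C_ε(|0…0⟩, |a⟩)`. -/
def circuitComplexity {n m : ℕ} (G : Finset (PlacedGate (n + m))) (ε : ℝ) (a : QState n) : ℕ∞ :=
  relativeComplexity G ε (zeroState n) a

/-- `f = Ω̃(N)` with `N = 2 ^ n`: up to a constant and a power of `log N`, the function is
eventually at least `N`. -/
def IsOmegaTildeN (f : ℕ → ℕ∞) : Prop :=
  ∃ A : ℝ, 0 < A ∧ ∃ k : ℕ, ∀ᶠ n : ℕ in atTop,
    ENNReal.ofReal (A * (2 : ℝ) ^ n / Real.log ((2 : ℝ) ^ n) ^ k) ≤ (f n : ENNReal)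

end

/-! The proof is a counting argument. Fix a circuit and let `v` be its output on the first `n`
qubits with the ancillas projected to zero, so that `‖v‖ ≤ 1`. Its overlap with a half-size subset
state is `|∑_{x ∈ S} v x| / √(N/2)`. For a uniformly random subset `S`, the sum concentrates around
`(∑ v)/2`, which has modulus at most `√N/2` and so accounts for an overlap of at most `1/√2`. An
excess `δ` occurs for at most a fraction `4 exp(-δ²N/4)` of all subsets
(`card_filter_half_norm_sum_le`). Half-size subsets form at least a fraction `1/N` of all subsets,
and there are only `exp(O(A N))` circuits with fewer than `A N / log N` gates. For small `A`, a
union bound (`card_easySubsets_le`) leaves a half-size subset that no such circuit prepares. -/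

noncomputable section

/-! ### Unitarity of circuits -/

/-- Splitting a register into the wires of a placed gate and all the other qubits. -/
def PlacedGate.splitEquiv {q : ℕ} (g : PlacedGate q) :
    BitString q ≃ BitString g.arity × ({i : Fin q // i ∉ Set.range g.wires} → Bool) := by
  classical
  exact (Equiv.piEquivPiSubtypeProd (fun i => i ∈ Set.range g.wires) (fun _ => Bool)).trans
    (Equiv.prodCongr
      (Equiv.arrowCongr (Equiv.ofInjective g.wires g.wires.injective).symm (Equiv.refl Bool))
      (Equiv.refl _))

lemma PlacedGate.splitEquiv_snd {q : ℕ} (g : PlacedGate q) (x : BitString q)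
    (i : {i : Fin q // i ∉ Set.range g.wires}) : (g.splitEquiv x).2 i = x i := rfl

open Kronecker in
lemma PlacedGate.toMatrix_eq {q : ℕ} (g : PlacedGate q) :
    g.toMatrix = ((g.gate : Matrix (BitString g.arity) (BitString g.arity) ℂ) ⊗ₖ
      (1 : Matrix ({i : Fin q // i ∉ Set.range g.wires} → Bool) _ ℂ)).submatrix
        g.splitEquiv g.splitEquiv := by
  classical
  ext x y
  have h : (g.splitEquiv x).2 = (g.splitEquiv y).2 ↔
      ∀ i, i ∉ Set.range g.wires → x i = y i := by
    simp only [funext_iff, Subtype.forall, PlacedGate.splitEquiv_snd]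
  simp only [PlacedGate.toMatrix, Matrix.submatrix_apply, Matrix.kroneckerMap_apply,
    Matrix.one_apply, h, mul_ite, mul_one, mul_zero]
  rfl

lemma PlacedGate.toMatrix_mem_unitaryGroup {q : ℕ} (g : PlacedGate q) :
    g.toMatrix ∈ Matrix.unitaryGroup (BitString q) ℂ := by
  classical
  have h := Matrix.kronecker_mem_unitary g.gate.2
    (one_mem (Matrix.unitaryGroup ({i : Fin q // i ∉ Set.range g.wires} → Bool) ℂ))
  have h' := (Unitary.mem_iff.1 h).2
  rw [Matrix.star_eq_conjTranspose] at h'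
  rw [Matrix.mem_unitaryGroup_iff, Matrix.star_eq_conjTranspose, g.toMatrix_eq,
    Matrix.conjTranspose_submatrix, Matrix.submatrix_mul_equiv, h']
  exact Matrix.submatrix_one_equiv g.splitEquiv

lemma circuitMatrix_mem_unitaryGroup {q : ℕ} (C : List (PlacedGate q)) :
    circuitMatrix C ∈ Matrix.unitaryGroup (BitString q) ℂ := by
  induction C with
  | nil => exact one_mem _
  | cons g C ih => exact mul_mem ih g.toMatrix_mem_unitaryGroup

/-! ### Output vectors and amplitudes -/

lemma withAncillas_zeroState (n m : ℕ) :
    withAncillas m (zeroState n) = zeroState (n + m) := by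
  ext x
  simp only [withAncillas, zeroState, PiLp.single_apply]
  have h : x = (fun _ => false) ↔ (∀ j : Fin m, x (Fin.natAdd n j) = false) ∧
      (fun i => x (Fin.castAdd m i)) = (fun _ => false) := by
    constructor
    · rintro rfl; simp
    · rintro ⟨h1, h2⟩
      funext i
      refine Fin.addCases (fun i => congrFun h2 i) h1 i
  by_cases h1 : ∀ j : Fin m, x (Fin.natAdd n j) = false <;> simp [h, h1]

/-- The unnormalised state `⟨0…0| C |0…0⟩|0…0⟩` left on the first `n` qubits. -/
def circuitOutput {n m : ℕ} (C : List (PlacedGate (n + m))) (y : BitString n) : ℂ :=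
  circuitMatrix C (Fin.append y fun _ => false) (fun _ => false)

lemma sum_norm_sq_col_of_mem_unitaryGroup {ι : Type*} [Fintype ι] [DecidableEq ι]
    {U : Matrix ι ι ℂ} (hU : U ∈ Matrix.unitaryGroup ι ℂ) (j : ι) :
    ∑ i, ‖U i j‖ ^ 2 = 1 := by
  have h := congrFun (congrFun (Matrix.mem_unitaryGroup_iff'.1 hU) j) j
  rw [Matrix.mul_apply, Matrix.one_apply_eq] at h
  have h2 : ∀ i, (star U) j i * U i j = ((‖U i j‖ ^ 2 : ℝ) : ℂ) := fun i => by
    rw [Matrix.star_apply, RCLike.star_def, Complex.conj_mul']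
    push_cast; rfl
  simp only [h2] at h
  exact_mod_cast h

lemma append_injective_left {n m : ℕ} (z : BitString m) :
    Function.Injective fun y : BitString n => (Fin.append y z : BitString (n + m)) := by
  intro y y' h
  funext i
  simpa using congrFun h (Fin.castAdd m i)

/-- The output is part of one column of a unitary matrix. -/
lemma sum_norm_sq_circuitOutput_le {n m : ℕ} (C : List (PlacedGate (n + m))) :
    ∑ y, ‖circuitOutput C y‖ ^ 2 ≤ 1 := by
  rw [← sum_norm_sq_col_of_mem_unitaryGroup (circuitMatrix_mem_unitaryGroup C) (fun _ => false)]
  refine (Finset.sum_image (s := Finset.univ)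
    (f := fun x => ‖circuitMatrix C x (fun _ => false)‖ ^ 2)
    (g := fun y : BitString n => (Fin.append y (fun _ => false) : BitString (n + m)))
    (append_injective_left _).injOn).symm.trans_le ?_
  exact Finset.sum_le_sum_of_subset_of_nonneg (Finset.subset_univ _) fun _ _ _ => by positivity

lemma transitionAmplitude_zeroState {n m : ℕ} (C : List (PlacedGate (n + m))) (b : QState n) :
    transitionAmplitude C (zeroState n) b = ∑ y, circuitOutput C y * star (b y) := by
  have hw : ∀ x, Matrix.toEuclideanLin (circuitMatrix C) (zeroState (n + m)) x =
      circuitMatrix C x (fun _ => false) := fun x => by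
    simp [Matrix.toLpLin_apply, zeroState, EuclideanSpace.single]
  rw [transitionAmplitude, withAncillas_zeroState, PiLp.inner_apply]
  simp only [hw, RCLike.inner_apply]
  rw [← (Fin.appendEquiv n m).sum_comp, Fintype.sum_prod_type]
  refine Finset.sum_congr rfl fun y _ => ?_
  rw [Finset.sum_eq_single (fun _ => false)]
  · simp [withAncillas, circuitOutput, Fin.appendEquiv]
  · intro z _ hz
    have : ¬ ∀ j, z j = false := fun h => hz (funext h)
    simp [withAncillas, Fin.appendEquiv, this]
  · simp

lemma transitionAmplitude_subsetState {n m : ℕ} (C : List (PlacedGate (n + m)))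
    (S : Finset (BitString n)) :
    ‖transitionAmplitude C (zeroState n) (subsetState S)‖ =
      ‖∑ y ∈ S, circuitOutput C y‖ / Real.sqrt S.card := by
  rw [transitionAmplitude_zeroState]
  have h : ∀ y, circuitOutput C y * star (subsetState S y) =
      if y ∈ S then circuitOutput C y * ((1 / Real.sqrt S.card : ℝ) : ℂ) else 0 := fun y => by
    by_cases hy : y ∈ S <;> simp [subsetState, hy]
  rw [Finset.sum_congr rfl fun y _ => h y, Finset.sum_ite_mem, Finset.univ_inter,
    ← Finset.sum_mul, norm_mul, Complex.norm_real, Real.norm_of_nonneg (by positivity)]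
  ring

/-! ### Concentration of random subset sums -/

/-- Expanding `∏ (e^w + e^(-w))` gives one term per `S`, with sign `+` on `S` and `-` off it. -/
lemma sum_exp_signed_sum {α : Type*} [Fintype α] [DecidableEq α] (w : α → ℝ) :
    ∑ S : Finset α, Real.exp (2 * ∑ x ∈ S, w x - ∑ x, w x) =
      2 ^ Fintype.card α * ∏ x, Real.cosh (w x) := by
  have h : ∀ x, 2 * Real.cosh (w x) = Real.exp (w x) + Real.exp (-w x) := fun x => by
    rw [Real.cosh_eq]; ring
  rw [← Finset.card_univ, ← Finset.prod_const, ← Finset.prod_mul_distrib,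
    Finset.prod_congr rfl fun x _ => h x, Finset.prod_add, Finset.powerset_univ]
  refine Finset.sum_congr rfl fun S _ => ?_
  rw [← Real.exp_sum, ← Real.exp_sum, ← Real.exp_add, Finset.sum_neg_distrib,
    ← Finset.sum_sdiff (Finset.subset_univ S)]
  ring_nf

/-- Chernoff bound with exponential parameter `4 * t`, using `cosh u ≤ exp (u² / 2)`. -/
lemma card_filter_deviation_le {α : Type*} [Fintype α] [DecidableEq α] (w : α → ℝ)
    (hw : ∑ x, w x ^ 2 ≤ 1) {t : ℝ} (ht : 0 ≤ t) :
    ((Finset.univ.filter fun S : Finset α => t ≤ ∑ x ∈ S, w x - (∑ x, w x) / 2).card : ℝ) ≤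
      2 ^ Fintype.card α * Real.exp (-(2 * t ^ 2)) := by
  set F := Finset.univ.filter fun S : Finset α => t ≤ ∑ x ∈ S, w x - (∑ x, w x) / 2
  have h1 : (F.card : ℝ) * Real.exp (4 * t ^ 2) ≤
      ∑ S : Finset α, Real.exp (2 * ∑ x ∈ S, 2 * t * w x - ∑ x, 2 * t * w x) := by
    rw [← nsmul_eq_mul]
    refine (Finset.card_nsmul_le_sum F _ _ fun S hS => ?_).trans
      (Finset.sum_le_sum_of_subset_of_nonneg (Finset.subset_univ F) fun _ _ _ => by positivity)
    have := (Finset.mem_filter.1 hS).2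
    rw [Real.exp_le_exp, ← Finset.mul_sum, ← Finset.mul_sum]
    nlinarith
  rw [sum_exp_signed_sum] at h1
  have h2 : ∏ x, Real.cosh (2 * t * w x) ≤ Real.exp (2 * t ^ 2) := by
    calc ∏ x, Real.cosh (2 * t * w x) ≤ ∏ x, Real.exp ((2 * t * w x) ^ 2 / 2) :=
          Finset.prod_le_prod (fun _ _ => (Real.cosh_pos _).le)
            fun _ _ => Real.cosh_le_exp_half_sq _
      _ = Real.exp (2 * t ^ 2 * ∑ x, w x ^ 2) := by
          rw [← Real.exp_sum, Finset.mul_sum]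
          exact congrArg _ (Finset.sum_congr rfl fun x _ => by ring)
      _ ≤ Real.exp (2 * t ^ 2) := by
          rw [Real.exp_le_exp]; nlinarith [sq_nonneg t]
  have h3 := h1.trans (mul_le_mul_of_nonneg_left h2 (by positivity))
  rw [← mul_le_mul_iff_left₀ (Real.exp_pos (4 * t ^ 2))]
  refine h3.trans_eq ?_
  rw [mul_assoc, ← Real.exp_add]
  ring_nf

/-- If the modulus is at least `2 * t`, the real or imaginary part is at least `t` in absolute
value; this gives four one-sided events. -/
lemma card_filter_norm_deviation_le {α : Type*} [Fintype α] [DecidableEq α] (v : α → ℂ)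
    (hv : ∑ x, ‖v x‖ ^ 2 ≤ 1) {t : ℝ} (ht : 0 ≤ t) :
    ((Finset.univ.filter fun S : Finset α => 2 * t ≤ ‖∑ x ∈ S, v x - (∑ x, v x) / 2‖).card : ℝ) ≤
      4 * (2 ^ Fintype.card α * Real.exp (-(2 * t ^ 2))) := by
  have hre : ∑ x, (v x).re ^ 2 ≤ 1 := (Finset.sum_le_sum fun x _ => by
    rw [Complex.sq_norm, Complex.normSq_apply]; nlinarith [sq_nonneg (v x).im]).trans hv
  have him : ∑ x, (v x).im ^ 2 ≤ 1 := (Finset.sum_le_sum fun x _ => by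
    rw [Complex.sq_norm, Complex.normSq_apply]; nlinarith [sq_nonneg (v x).re]).trans hv
  have h1 := card_filter_deviation_le (fun x => (v x).re) hre ht
  have h2 := card_filter_deviation_le (fun x => -(v x).re) (by simpa using hre) ht
  have h3 := card_filter_deviation_le (fun x => (v x).im) him ht
  have h4 := card_filter_deviation_le (fun x => -(v x).im) (by simpa using him) ht
  set F1 := Finset.univ.filter fun S : Finset α =>
    t ≤ ∑ x ∈ S, (v x).re - (∑ x, (v x).re) / 2
  set F2 := Finset.univ.filter fun S : Finset α =>
    t ≤ ∑ x ∈ S, -(v x).re - (∑ x, -(v x).re) / 2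
  set F3 := Finset.univ.filter fun S : Finset α =>
    t ≤ ∑ x ∈ S, (v x).im - (∑ x, (v x).im) / 2
  set F4 := Finset.univ.filter fun S : Finset α =>
    t ≤ ∑ x ∈ S, -(v x).im - (∑ x, -(v x).im) / 2
  have hsub : (Finset.univ.filter fun S : Finset α =>
      2 * t ≤ ‖∑ x ∈ S, v x - (∑ x, v x) / 2‖) ⊆ (F1 ∪ F2) ∪ (F3 ∪ F4) := by
    intro S hS
    have hS := (Finset.mem_filter.1 hS).2.trans (Complex.norm_le_abs_re_add_abs_im _)
    simp only [Complex.sub_re, Complex.sub_im, Complex.re_sum, Complex.im_sum,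
      Complex.div_ofNat_re, Complex.div_ofNat_im] at hS
    simp only [F1, F2, F3, F4, Finset.mem_union, Finset.mem_filter, Finset.mem_univ, true_and,
      Finset.sum_neg_distrib]
    by_contra hcon
    push Not at hcon
    obtain ⟨⟨a1, a2⟩, a3, a4⟩ := hcon
    have b1 := abs_lt.2 ⟨by linarith, a1⟩
    have b2 := abs_lt.2 ⟨by linarith, a3⟩
    linarith
  have hc : (Finset.univ.filter fun S : Finset α =>
      2 * t ≤ ‖∑ x ∈ S, v x - (∑ x, v x) / 2‖).card ≤ (F1.card + F2.card) + (F3.card + F4.card) :=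
    (Finset.card_le_card hsub).trans <| (Finset.card_union_le _ _).trans <|
      add_le_add (Finset.card_union_le _ _) (Finset.card_union_le _ _)
  have hc' : ((Finset.univ.filter fun S : Finset α =>
      2 * t ≤ ‖∑ x ∈ S, v x - (∑ x, v x) / 2‖).card : ℝ) ≤
        (F1.card + F2.card) + (F3.card + F4.card) := by exact_mod_cast hc
  linarith

lemma norm_sum_le_sqrt_card {α : Type*} [Fintype α] (v : α → ℂ)
    (hv : ∑ x, ‖v x‖ ^ 2 ≤ 1) : ‖∑ x, v x‖ ≤ Real.sqrt (Fintype.card α) := by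
  refine (norm_sum_le _ _).trans (Real.le_sqrt_of_sq_le ?_)
  have h := sq_sum_le_card_mul_sum_sq (s := Finset.univ) (f := fun x => ‖v x‖)
  rw [Finset.card_univ] at h
  exact h.trans (mul_le_of_le_one_right (by positivity) hv)

/-- Few half-size subsets have a normalised sum of `v` well above `1 / √2`. -/
lemma card_filter_half_norm_sum_le {α : Type*} [Fintype α] [DecidableEq α] [Nonempty α]
    (v : α → ℂ) (hv : ∑ x, ‖v x‖ ^ 2 ≤ 1) {δ : ℝ} (hδ : 0 ≤ δ) :
    ((Finset.univ.filter fun S : Finset α => 2 * S.card = Fintype.card α ∧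
        1 / Real.sqrt 2 + δ ≤ ‖∑ x ∈ S, v x‖ / Real.sqrt S.card).card : ℝ) ≤
      4 * (2 ^ Fintype.card α * Real.exp (-(δ ^ 2 * Fintype.card α / 4))) := by
  -- `r` is `√|S|` for a half-size `S`; taking `t = δ * r / 2` makes the deviation threshold `2 * t
  -- = δ * r`.
  set r := Real.sqrt (Fintype.card α / 2 : ℝ) with hr
  have hN : (0 : ℝ) < Fintype.card α := by exact_mod_cast Fintype.card_pos
  have hrpos : 0 < r := Real.sqrt_pos.2 (by positivity)
  have hrsq : r ^ 2 = Fintype.card α / 2 := Real.sq_sqrt (by positivity)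
  have key := card_filter_norm_deviation_le v hv (t := δ * r / 2) (by positivity)
  have he : 2 * (δ * r / 2) ^ 2 = δ ^ 2 * Fintype.card α / 4 := by
    rw [div_pow, mul_pow, hrsq]; ring
  rw [he] at key
  refine le_trans ?_ key
  refine Nat.cast_le.2 (Finset.card_le_card fun S hS => ?_)
  obtain ⟨hcard, hS⟩ := (Finset.mem_filter.1 hS).2
  refine Finset.mem_filter.2 ⟨Finset.mem_univ _, ?_⟩
  have hcard' : (S.card : ℝ) = Fintype.card α / 2 := by
    rw [← hcard]; push_cast; ring
  rw [hcard', ← hr, le_div_iff₀ hrpos] at hS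
  have hmean := norm_sum_le_sqrt_card v hv
  have hsq : Real.sqrt (Fintype.card α) = Real.sqrt 2 * r := by
    rw [hr, ← Real.sqrt_mul (by norm_num)]; congr 1; ring
  have h2 : Real.sqrt 2 * Real.sqrt 2 = 2 := Real.mul_self_sqrt (by norm_num)
  have h3 : 1 / Real.sqrt 2 = Real.sqrt 2 / 2 := by
    rw [div_eq_div_iff (by positivity) (by norm_num)]; linarith
  have htri := norm_sub_norm_le (∑ x ∈ S, v x) ((∑ x, v x) / 2)
  have hhalf : ‖(∑ x, v x) / 2‖ = ‖∑ x, v x‖ / 2 := by simp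
  rw [hhalf] at htri
  rw [h3] at hS
  rw [hsq] at hmean
  nlinarith

/-! ### Counting easy subsets -/

/-- The half-size subsets whose state some circuit with fewer than `L` gates prepares well. -/
def easySubsets {n m : ℕ} (G : Finset (PlacedGate (n + m))) (η : ℝ) (L : ℕ) :
    Finset (Finset (BitString n)) :=
  open Classical in
  Finset.univ.filter fun S => 2 * S.card = 2 ^ n ∧ ∃ C : List (PlacedGate (n + m)),
    (∀ g ∈ C, g ∈ G) ∧ C.length < L ∧
      η ≤ ‖transitionAmplitude C (zeroState n) (subsetState S)‖

lemma mem_easySubsets {n m : ℕ} {G : Finset (PlacedGate (n + m))} {η : ℝ} {L : ℕ}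
    {S : Finset (BitString n)} : S ∈ easySubsets G η L ↔
      2 * S.card = 2 ^ n ∧ ∃ C : List (PlacedGate (n + m)), (∀ g ∈ C, g ∈ G) ∧ C.length < L ∧
        η ≤ ‖transitionAmplitude C (zeroState n) (subsetState S)‖ := by
  simp [easySubsets]

lemma card_easySubsets_le {n m : ℕ} (G : Finset (PlacedGate (n + m))) {δ : ℝ} (hδ : 0 ≤ δ)
    (L : ℕ) :
    ((easySubsets G (1 / Real.sqrt 2 + δ) L).card : ℝ) ≤
      (∑ l ∈ Finset.range L, (G.card : ℝ) ^ l) *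
        (4 * (2 ^ 2 ^ n * Real.exp (-(δ ^ 2 * 2 ^ n / 4)))) := by
  classical
  set K : ℝ := 4 * (2 ^ 2 ^ n * Real.exp (-(δ ^ 2 * 2 ^ n / 4)))
  have hcardα : Fintype.card (BitString n) = 2 ^ n := by simp
  let c (l : ℕ) (f : Fin l → G) : List (PlacedGate (n + m)) := List.ofFn fun i => (f i).1
  let B (l : ℕ) (f : Fin l → G) : Finset (Finset (BitString n)) :=
    Finset.univ.filter fun S => 2 * S.card = Fintype.card (BitString n) ∧
      1 / Real.sqrt 2 + δ ≤ ‖∑ y ∈ S, circuitOutput (c l f) y‖ / Real.sqrt S.card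
  have hB : ∀ l f, ((B l f).card : ℝ) ≤ K := fun l f => by
    have := card_filter_half_norm_sum_le (circuitOutput (c l f))
      (sum_norm_sq_circuitOutput_le _) hδ
    rw [hcardα] at this
    simpa [B, K] using this
  have hsub : easySubsets G (1 / Real.sqrt 2 + δ) L ⊆
      (Finset.range L).biUnion fun l => Finset.univ.biUnion (B l) := by
    intro S hS
    obtain ⟨hcard, C, hCG, hCL, hC⟩ := mem_easySubsets.1 hS
    simp only [Finset.mem_biUnion, Finset.mem_range, Finset.mem_univ, true_and]
    refine ⟨C.length, hCL, fun i => ⟨C.get i, hCG _ (List.get_mem _ _)⟩, ?_⟩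
    have hc : c C.length (fun i => ⟨C.get i, hCG _ (List.get_mem _ _)⟩) = C := by
      simp only [c]; exact List.ofFn_get C
    refine Finset.mem_filter.2 ⟨Finset.mem_univ _, hcard.trans hcardα.symm, ?_⟩
    rwa [hc, ← transitionAmplitude_subsetState]
  calc ((easySubsets G (1 / Real.sqrt 2 + δ) L).card : ℝ)
      ≤ ∑ l ∈ Finset.range L, ∑ f : Fin l → G, ((B l f).card : ℝ) := by
        have h := (Finset.card_le_card hsub).trans (Finset.card_biUnion_le.trans
          (Finset.sum_le_sum fun l _ => Finset.card_biUnion_le))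
        exact_mod_cast h
    _ ≤ ∑ l ∈ Finset.range L, ∑ _f : Fin l → G, K :=
        Finset.sum_le_sum fun l _ => Finset.sum_le_sum fun f _ => hB l f
    _ = (∑ l ∈ Finset.range L, (G.card : ℝ) ^ l) * K := by
        rw [Finset.sum_mul]
        exact Finset.sum_congr rfl fun l _ => by simp

/-- This is the central binomial bound `4^j ≤ 2j * centralBinom j` at `j = N/2`. -/
lemma two_pow_le_card_half_subsets {n : ℕ} (hn : 1 ≤ n) :
    2 ^ 2 ^ n ≤ 2 ^ n *
      (Finset.univ.filter fun S : Finset (BitString n) => 2 * S.card = 2 ^ n).card := by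
  obtain ⟨k, rfl⟩ := Nat.exists_eq_add_of_le' hn
  have hset : (Finset.univ.filter fun S : Finset (BitString (k + 1)) =>
      2 * S.card = 2 ^ (k + 1)) = Finset.univ.powersetCard (2 ^ k) := by
    ext S
    simp only [Finset.mem_filter, Finset.mem_univ, true_and, Finset.mem_powersetCard,
      Finset.subset_univ, pow_succ]
    omega
  have h := Nat.four_pow_le_two_mul_self_mul_centralBinom (2 ^ k) (by positivity)
  rw [hset, Finset.card_powersetCard, Finset.card_univ]
  have hc : Fintype.card (BitString (k + 1)) = 2 * 2 ^ k := by simp [pow_succ, mul_comm]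
  rw [hc, ← Nat.centralBinom_eq_two_mul_choose, pow_succ, mul_comm (2 ^ k) 2, pow_mul]
  exact h

lemma le_circuitComplexity_of_notMem_easySubsets {n m : ℕ} {G : Finset (PlacedGate (n + m))}
    {ε η : ℝ} (hη : η ≤ 1 - ε) {L : ℕ} {S : Finset (BitString n)} (hS : 2 * S.card = 2 ^ n)
    (h : S ∉ easySubsets G η L) : (L : ℕ∞) ≤ circuitComplexity G ε (subsetState S) := by
  refine le_iInf fun C => le_iInf fun hC => le_iInf fun hamp => ?_
  by_contra hlt
  exact h (mem_easySubsets.2 ⟨hS, C, hC, by exact_mod_cast not_le.1 hlt, hη.trans hamp⟩)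

lemma exists_notMem_easySubsets {n m : ℕ} (hn : 1 ≤ n) (G : Finset (PlacedGate (n + m)))
    {η : ℝ} {L : ℕ} (h : (2 : ℝ) ^ n * (easySubsets G η L).card < 2 ^ 2 ^ n) :
    ∃ S : Finset (BitString n), 2 * S.card = 2 ^ n ∧ S ∉ easySubsets G η L := by
  by_contra! hcon
  have hsub : (Finset.univ.filter fun S : Finset (BitString n) => 2 * S.card = 2 ^ n) ⊆
      easySubsets G η L := fun S hS => hcon S (Finset.mem_filter.1 hS).2
  have h1 : 2 ^ 2 ^ n ≤ 2 ^ n * (easySubsets G η L).card :=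
    (two_pow_le_card_half_subsets hn).trans
      (Nat.mul_le_mul_left _ (Finset.card_le_card hsub))
  have h2 : (2 : ℝ) ^ 2 ^ n ≤ 2 ^ n * (easySubsets G η L).card := by exact_mod_cast h1
  linarith

lemma exists_card_eq_half {n : ℕ} (hn : 1 ≤ n) :
    ∃ S : Finset (BitString n), 2 * S.card = 2 ^ n := by
  obtain ⟨k, rfl⟩ := Nat.exists_eq_add_of_le' hn
  obtain ⟨S, -, hS⟩ := Finset.exists_subset_card_eq
    (s := (Finset.univ : Finset (BitString (k + 1)))) (n := 2 ^ k) (by simp [pow_succ])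
  exact ⟨S, by rw [hS, pow_succ, mul_comm]⟩

/-! ### Asymptotics and choice of constants -/

lemma sum_pow_range_ceil_le {g N A : ℝ} {d : ℕ} (hg : 0 ≤ g) (hgN : g ≤ N ^ d) (hA : 0 ≤ A)
    (hlog : 1 ≤ Real.log N) (hN : 1 ≤ N) :
    ∑ l ∈ Finset.range ⌈A * N / Real.log N⌉₊, g ^ l ≤
      (A + 1) * N * Real.exp (d * A * N) := by
  have hB : A * N / Real.log N ≤ A * N := div_le_self (by positivity) hlog
  have hceil : (⌈A * N / Real.log N⌉₊ : ℝ) ≤ (A + 1) * N := by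
    have := (Nat.ceil_lt_add_one (a := A * N / Real.log N) (by positivity)).le
    linarith
  have hterm : ∀ l ∈ Finset.range ⌈A * N / Real.log N⌉₊, g ^ l ≤ Real.exp (d * A * N) := by
    intro l hl
    have hl' : (l : ℝ) < A * N / Real.log N := Nat.lt_ceil.1 (Finset.mem_range.1 hl)
    rw [lt_div_iff₀ (by linarith)] at hl'
    calc g ^ l ≤ (N ^ d) ^ l := pow_le_pow_left₀ hg hgN l
      _ = Real.exp (d * (l * Real.log N)) := by
          rw [← pow_mul, ← mul_assoc, ← Nat.cast_mul, Real.exp_nat_mul,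
            Real.exp_log (by linarith)]
      _ ≤ Real.exp (d * A * N) := by
          rw [Real.exp_le_exp, mul_assoc]
          exact mul_le_mul_of_nonneg_left hl'.le (Nat.cast_nonneg d)
  refine (Finset.sum_le_card_nsmul _ _ _ hterm).trans ?_
  rw [Finset.card_range, nsmul_eq_mul]
  exact mul_le_mul_of_nonneg_right hceil (Real.exp_pos _).le

lemma tendsto_two_pow_sq_mul_exp_neg {κ : ℝ} (hκ : 0 < κ) :
    Tendsto (fun n : ℕ => ((2 : ℝ) ^ n) ^ 2 * Real.exp (-(κ * 2 ^ n))) atTop (𝓝 0) := by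
  have h1 : Tendsto (fun n : ℕ => κ * (2 : ℝ) ^ n) atTop atTop :=
    (tendsto_pow_atTop_atTop_of_one_lt one_lt_two).const_mul_atTop hκ
  have h2 := ((Real.tendsto_pow_mul_exp_neg_atTop_nhds_zero 2).comp h1).const_mul ((κ ^ 2)⁻¹)
  rw [mul_zero] at h2
  refine h2.congr fun n => ?_
  simp only [Function.comp_apply]
  field_simp

lemma eventually_exists_hard_subset (m : ℕ → ℕ) (G : (n : ℕ) → Finset (PlacedGate (n + m n)))
    (d : ℕ) (hG : ∀ᶠ n : ℕ in atTop, (G n).card ≤ (2 ^ n) ^ d) {δ : ℝ} (hδ : 0 < δ) :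
    ∀ᶠ n : ℕ in atTop, ∃ S : Finset (BitString n), 2 * S.card = 2 ^ n ∧
      S ∉ easySubsets (G n) (1 / Real.sqrt 2 + δ)
        ⌈δ ^ 2 / (8 * (d + 1)) * 2 ^ n / Real.log (2 ^ n)⌉₊ := by
  -- This makes `d * A ≤ δ²/8`, so counting circuits costs at most half of the decay rate `δ²/4`; `d
  -- + 1` covers `d = 0`.
  set A : ℝ := δ ^ 2 / (8 * (d + 1)) with hAdef
  have hA : 0 < A := by positivity
  have hdA : d * A ≤ δ ^ 2 / 8 := by
    have : δ ^ 2 / 8 = d * A + A := by rw [hAdef]; field_simp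
    linarith
  have hlim := (tendsto_two_pow_sq_mul_exp_neg (κ := δ ^ 2 / 8) (by positivity)).const_mul
    (4 * (A + 1))
  rw [mul_zero] at hlim
  filter_upwards [hG, eventually_ge_atTop 2, hlim.eventually_lt_const one_pos] with n hGn hn hsmall
  refine exists_notMem_easySubsets (by omega) (G n) ?_
  have hlog : 1 ≤ Real.log ((2 : ℝ) ^ n) := by
    rw [Real.log_pow]
    have : (2 : ℝ) ≤ n := by exact_mod_cast hn
    nlinarith [Real.log_two_gt_d9]
  have hN : (1 : ℝ) ≤ 2 ^ n := one_le_pow₀ one_le_two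
  have hsum := sum_pow_range_ceil_le (g := (G n).card) (d := d) (Nat.cast_nonneg _)
    (by exact_mod_cast hGn) hA.le hlog hN
  have hcard := card_easySubsets_le (G n) hδ.le ⌈A * 2 ^ n / Real.log (2 ^ n)⌉₊
  set N : ℝ := 2 ^ n
  have hexp : Real.exp (d * A * N) * Real.exp (-(δ ^ 2 * N / 4)) ≤
      Real.exp (-(δ ^ 2 / 8 * N)) := by
    rw [← Real.exp_add, Real.exp_le_exp]
    nlinarith
  calc N * ((easySubsets (G n) (1 / Real.sqrt 2 + δ) ⌈A * N / Real.log N⌉₊).card : ℝ)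
      ≤ N * (((A + 1) * N * Real.exp (d * A * N)) *
          (4 * (2 ^ 2 ^ n * Real.exp (-(δ ^ 2 * N / 4))))) := by
        refine mul_le_mul_of_nonneg_left (hcard.trans ?_) (by positivity)
        exact mul_le_mul_of_nonneg_right hsum (by positivity)
    _ = 4 * (A + 1) * (N ^ 2 * (Real.exp (d * A * N) * Real.exp (-(δ ^ 2 * N / 4)))) *
          2 ^ 2 ^ n := by ring
    _ ≤ 4 * (A + 1) * (N ^ 2 * Real.exp (-(δ ^ 2 / 8 * N))) * 2 ^ 2 ^ n := by gcongr
    _ < 1 * 2 ^ 2 ^ n := by gcongr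
    _ = 2 ^ 2 ^ n := one_mul _

end

theorem mainTheorem9
    (m : ℕ → ℕ) (G : (n : ℕ) → Finset (PlacedGate (n + m n)))
    (d : ℕ) (hG : ∀ᶠ n : ℕ in atTop, (G n).card ≤ (2 ^ n) ^ d)
    (ε : ℕ → ℝ) (hε : Tendsto (fun n : ℕ => ε n * (2 : ℝ) ^ n) atTop atTop)
    (c : ℝ) (hc : c < 1 - 1 / Real.sqrt 2) (hεc : ∀ᶠ n : ℕ in atTop, ε n ≤ c) :
    ∃ S : (n : ℕ) → Finset (BitString n),
      (∀ n : ℕ, 1 ≤ n → 2 * (S n).card = 2 ^ n) ∧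
      IsOmegaTildeN (fun n => circuitComplexity (G n) (ε n) (subsetState (S n))) := by
  -- Then `1/√2 + δ = 1 - c ≤ 1 - ε n` eventually.
  set δ : ℝ := 1 - c - 1 / Real.sqrt 2 with hδdef
  have hδ : 0 < δ := by linarith
  let A : ℝ := δ ^ 2 / (8 * (d + 1))
  let Hard (n : ℕ) (S : Finset (BitString n)) : Prop := 2 * S.card = 2 ^ n ∧
    S ∉ easySubsets (G n) (1 / Real.sqrt 2 + δ) ⌈A * 2 ^ n / Real.log (2 ^ n)⌉₊
  -- For `n` with no hard subset any half-size subset serves, and at `n = 0`, where none exists, `∅`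
  -- does.
  have hchoice : ∀ n : ℕ, ∃ S : Finset (BitString n),
      (1 ≤ n → 2 * S.card = 2 ^ n) ∧ ((∃ T, Hard n T) → Hard n S) := by
    intro n
    by_cases h : ∃ T, Hard n T
    · obtain ⟨T, hT⟩ := h
      exact ⟨T, fun _ => hT.1, fun _ => hT⟩
    · by_cases hn : 1 ≤ n
      · obtain ⟨T, hT⟩ := exists_card_eq_half hn
        exact ⟨T, fun _ => hT, fun h' => absurd h' h⟩
      · exact ⟨∅, fun h' => absurd h' hn, fun h' => absurd h' h⟩
  choose S hScard hShard using hchoice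
  refine ⟨S, hScard, A, by positivity, 1, ?_⟩
  filter_upwards [eventually_exists_hard_subset m G d hG hδ, hεc] with n hex hεn
  obtain ⟨hcard, hnot⟩ := hShard n hex
  have hle := le_circuitComplexity_of_notMem_easySubsets (ε := ε n)
    (by rw [hδdef]; linarith) hcard hnot
  rw [pow_one]
  calc ENNReal.ofReal (A * 2 ^ n / Real.log (2 ^ n))
      ≤ ENNReal.ofReal (⌈A * 2 ^ n / Real.log (2 ^ n)⌉₊ : ℝ) :=
        ENNReal.ofReal_le_ofReal (Nat.le_ceil _)
    _ = ((⌈A * 2 ^ n / Real.log (2 ^ n)⌉₊ : ℕ∞) : ENNReal) := by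
        rw [ENNReal.ofReal_natCast, ENat.toENNReal_coe]
    _ ≤ _ := ENat.toENNReal_le.2 hle
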